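/- Let $n\ge 1$, let $w:\mathbb{R}^n\to[0,\infty)$, and suppose that $\Sigma:=\{x\in\mathbb{R}^n : w(x)>0\}$ is nonempty, open and convex. Assume that $\log w$ is twice differentiable on $\Sigma$ and satisfies $(\star)\qquad -\nabla^2(\log w)(x)\ge K\,\mathbb{I}$ for all $x\in\Sigma$, for some constant $K>-1$, and let $K_w$ be the largest constant $K$ for which this inequality holds on $\Sigma$. Then $\int_\Sigma w(x)e^{-|x|^2/2}\,dx$ is positive and finite, so that $$d\mu_w=\frac{w(x)e^{-|x|^2/2}\,dx}{\int_\Sigma w(x)e^{-|x|^2/2}\,dx}$$ is a probability measure on $\Sigma$. Let $A$ be the set of all $u\in C_0^\infty(\overline\Sigma)$ (restrictions to $\overline\Sigma$ of compactly supported smooth functions on $\mathbb{R}^n$) such that $\nabla u\cdot\eta=0$ at every point of $\partial\Sigma$ at which $\Sigma$ has a unique outward unit normal $\eta$. For $q\ge 2$ let $W^{1,q}_A(\Sigma,\mu_w)$ be the completion of $A$ with respect to the norm $$\Bigl(\int_\Sigma|u|^q\,d\mu_w\Bigr)^{1/q}+\Bigl(\int_\Sigma|\nabla u|^q\,d\mu_w\Bigr)^{1/q},$$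 that is, the space of $f\in L^q(\mu_w)$ with gradient $\nabla f\in L^q(\mu_w;\mathbb{R}^n)$ for which there are $u_k\in A$ with $u_k\to f$ and $\nabla u_k\to\nabla f$ in $L^q(\mu_w)$. Then, for every real $q\ge 2$ and every $f\in W^{1,q}_A(\Sigma,\mu_w)$, $$\int_\Sigma\Bigl|f-\int_\Sigma f\,d\mu_w\Bigr|^2d\mu_w\le\frac{1}{1+K_w}\Bigl(\int_\Sigma|\nabla f|^q\,d\mu_w\Bigr)^{2/q}.$$ -/

import Mathlib

open scoped ContDiff Topology

noncomputable section

/-- The set `Σ = {x : w x > 0}` on which the weight lives. -/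
def weightSupport {n : ℕ} (w : EuclideanSpace ℝ (Fin n) → ℝ) :
    Set (EuclideanSpace ℝ (Fin n)) :=
  {x | 0 < w x}

/-- The Hessian quadratic form `v ↦ ⟨∇² (log w)(x) v, v⟩`. -/
def hessLog {n : ℕ} (w : EuclideanSpace ℝ (Fin n) → ℝ) (x v : EuclideanSpace ℝ (Fin n)) : ℝ :=
  fderiv ℝ (fderiv ℝ (fun y => Real.log (w y))) x v v

/-- `-∇² (log w(x)) ≥ K · I` (as quadratic forms) for all `x ∈ Σ`. -/
def HessianBound {n : ℕ} (w : EuclideanSpace ℝ (Fin n) → ℝ) (K : ℝ) : Prop :=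
  ∀ x ∈ weightSupport w, ∀ v : EuclideanSpace ℝ (Fin n), K * ‖v‖ ^ 2 ≤ -hessLog w x v

/-- Condition (⋆): `log w` is twice differentiable on `Σ` and
`-∇² (log w) ≥ K · I` on `Σ` for some constant `K > -1`. -/
def StarCondition {n : ℕ} (w : EuclideanSpace ℝ (Fin n) → ℝ) : Prop :=
  (∀ x ∈ weightSupport w, DifferentiableAt ℝ (fun y => Real.log (w y)) x) ∧
  (∀ x ∈ weightSupport w, DifferentiableAt ℝ (fderiv ℝ (fun y => Real.log (w y))) x) ∧
  ∃ K : ℝ, -1 < K ∧ HessianBound w K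

/-- `K_w`, the largest constant `K` with `-∇² (log w) ≥ K · I` on `Σ`
(it is attained, see `isGreatest_curvatureConst`). -/
def curvatureConst {n : ℕ} (w : EuclideanSpace ℝ (Fin n) → ℝ) : ℝ :=
  sSup {K : ℝ | HessianBound w K}

theorem isGreatest_curvatureConst {n : ℕ} (hn : 1 ≤ n) (w : EuclideanSpace ℝ (Fin n) → ℝ)
    (hne : (weightSupport w).Nonempty) (hw : StarCondition w) :
    IsGreatest {K : ℝ | HessianBound w K} (curvatureConst w) := by
  obtain ⟨-, -, K₀, -, hK₀⟩ := hw
  obtain ⟨x₀, hx₀⟩ := hne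
  have hbdd : BddAbove {K : ℝ | HessianBound w K} := by
    refine ⟨-hessLog w x₀ (EuclideanSpace.single ⟨0, hn⟩ 1), fun K hK => ?_⟩
    have h := hK x₀ hx₀ (EuclideanSpace.single ⟨0, hn⟩ 1)
    simpa using h
  refine ⟨fun x hx v => ?_, fun K hK => le_csSup hbdd hK⟩
  rcases eq_or_ne v 0 with rfl | hv
  · simpa using hK₀ x hx 0
  · have hpos : 0 < ‖v‖ ^ 2 := by positivity
    rw [← le_div_iff₀ hpos]
    exact csSup_le ⟨K₀, hK₀⟩ fun K hK => (le_div_iff₀ hpos).2 (hK x hx v)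

/-- The measure `w(x) exp(-|x|²/2) dx` on `Σ`, before normalization. -/
def unnormalizedMeasure {n : ℕ} (w : EuclideanSpace ℝ (Fin n) → ℝ) :
    MeasureTheory.Measure (EuclideanSpace ℝ (Fin n)) :=
  (MeasureTheory.volume.restrict (weightSupport w)).withDensity
    fun x => ENNReal.ofReal (w x * Real.exp (-‖x‖ ^ 2 / 2))

/-- The weighted Gaussian measure
`dμ_w = w(x) exp(-|x|²/2) dx / ∫_Σ w(x) exp(-|x|²/2) dx`. -/
def weightedGaussian {n : ℕ} (w : EuclideanSpace ℝ (Fin n) → ℝ) :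
    MeasureTheory.Measure (EuclideanSpace ℝ (Fin n)) :=
  (unnormalizedMeasure w Set.univ)⁻¹ • unnormalizedMeasure w

/-- `η` is an outward unit normal of the convex set `S` at `x`: the half-space with outward
unit normal `η` whose boundary passes through `x` contains `S`. -/
def IsOutwardUnitNormal {n : ℕ} (S : Set (EuclideanSpace ℝ (Fin n)))
    (x η : EuclideanSpace ℝ (Fin n)) : Prop :=
  ‖η‖ = 1 ∧ ∀ y ∈ S, inner ℝ η (y - x) ≤ 0

/-- The class `A` of functions `u ∈ C_0^∞(closure S)` with `∇u · η = 0` on `∂S`, for an open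
convex set `S`. Functions that are smooth up to the boundary and have compact support are taken
as (restrictions to `closure S` of) smooth compactly supported functions on `ℝⁿ`; their support
may meet `∂S`. The boundary condition is imposed at each boundary point at which `S` has
an outer normal, that is, exactly one outward unit normal (so not at corners and edges). -/
def IsNeumannTest {n : ℕ} (S : Set (EuclideanSpace ℝ (Fin n)))
    (u : EuclideanSpace ℝ (Fin n) → ℝ) : Prop :=
  ContDiff ℝ ∞ u ∧ HasCompactSupport u ∧
  ∀ x ∈ frontier S, ∀ η : EuclideanSpace ℝ (Fin n),
    IsOutwardUnitNormal S x η → (∀ η', IsOutwardUnitNormal S x η' → η' = η) →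
    inner ℝ (gradient u x) η = 0

/-- `f ∈ W^{1,q}_A(Σ, μ_w)` with gradient `∇f = g`. The completion of `A` for the norm
`‖u‖_{L^q(μ_w)} + ‖∇u‖_{L^q(μ_w)}` is realized as the closure of `{(u, ∇u) : u ∈ A}` in
`L^q(μ_w) × L^q(μ_w; ℝⁿ)`: there are `u_k ∈ A` with `u_k → f` and `∇u_k → g` in `L^q(μ_w)`. -/
def IsSobolevWithGradient {n : ℕ} (w : EuclideanSpace ℝ (Fin n) → ℝ) (q : ℝ)
    (f : EuclideanSpace ℝ (Fin n) → ℝ)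
    (g : EuclideanSpace ℝ (Fin n) → EuclideanSpace ℝ (Fin n)) : Prop :=
  MeasureTheory.MemLp f (ENNReal.ofReal q) (weightedGaussian w) ∧
  MeasureTheory.MemLp g (ENNReal.ofReal q) (weightedGaussian w) ∧
  ∃ u : ℕ → EuclideanSpace ℝ (Fin n) → ℝ,
    (∀ k, IsNeumannTest (weightSupport w) (u k)) ∧
    Filter.Tendsto
      (fun k => MeasureTheory.eLpNorm (fun x => u k x - f x) (ENNReal.ofReal q)
        (weightedGaussian w)) Filter.atTop (𝓝 0) ∧
    Filter.Tendsto
      (fun k => MeasureTheory.eLpNorm (fun x => gradient (u k) x - g x) (ENNReal.ofReal q)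
        (weightedGaussian w)) Filter.atTop (𝓝 0)

end

/-!
The density `w(x) exp(-|x|²/2)` is strongly log-concave with modulus `κ = 1 + K_w`. By the
Prékopa–Leindler inequality its normalization `μ` has Maurey's property `(τ)`:
`∫ e^φ dμ · ∫ e^ψ dμ ≤ 1` whenever `φ x + ψ y ≤ κ/4 · ‖x - y‖²`. For `u` of class `C²` with compact
support, Taylor's formula and Young's inequality make `φ = t u - t² (κ - O(t))⁻¹ ‖∇u‖²` and
`ψ = -t u` an admissible pair. Comparing the terms of order `t²` as `t → 0`, and using
`∫ e^{tu} dμ · ∫ e^{-tu} dμ ≥ 1 + t² Var u`, gives the Poincaré inequality with constant `1/κ`.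
It passes to Sobolev limits in `L²`, and Jensen's inequality replaces `L²` by `L^q` on the gradient
side.
-/

open Filter MeasureTheory ProbabilityTheory Set
open scoped ENNReal Pointwise

section PrekopaLeindler

theorem volume_add_volume_le_volume_add_of_isCompact {A B : Set ℝ} (hA : IsCompact A)
    (hB : IsCompact B) (hA_ne : A.Nonempty) (hB_ne : B.Nonempty) :
    volume A + volume B ≤ volume (A + B) := by
  obtain ⟨a, haA, ha⟩ := hA.exists_isGreatest hA_ne
  obtain ⟨b, hbB, hb⟩ := hB.exists_isLeast hB_ne
  have h_meas : MeasurableSet (a +ᵥ B) := (hB.vadd a).measurableSet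
  have h_inter : (b +ᵥ A) ∩ (a +ᵥ B) ⊆ {a + b} := by
    rintro _ ⟨⟨x, hx, rfl⟩, ⟨y, hy, hxy⟩⟩
    simp only [vadd_eq_add, mem_singleton_iff] at hxy ⊢
    linarith [ha hx, hb hy]
  calc volume A + volume B = volume (b +ᵥ A) + volume (a +ᵥ B) := by simp only [measure_vadd]
    _ = volume ((b +ᵥ A) ∪ (a +ᵥ B)) :=
      (measure_union₀ h_meas.nullMeasurableSet
        (measure_mono_null h_inter (measure_singleton _))).symm
    _ ≤ volume (A + B) := by
      refine measure_mono (union_subset ?_ ?_)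
      · rintro _ ⟨x, hx, rfl⟩
        exact ⟨x, hx, b, hbB, add_comm x b⟩
      · rintro _ ⟨y, hy, rfl⟩
        exact ⟨a, haA, y, hy, rfl⟩

theorem volume_add_volume_le_volume_add {A B : Set ℝ} (hA : MeasurableSet A)
    (hB : MeasurableSet B) (hA_ne : A.Nonempty) (hB_ne : B.Nonempty) :
    volume A + volume B ≤ volume (A + B) := by
  obtain ⟨a, ha⟩ := hA_ne
  obtain ⟨b, hb⟩ := hB_ne
  rw [hA.measure_eq_iSup_isCompact, hB.measure_eq_iSup_isCompact]
  simp only [iSup_and', iSup_subtype']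
  have : Nonempty {K : Set ℝ // K ⊆ A ∧ IsCompact K} := ⟨⟨∅, by simp⟩⟩
  have : Nonempty {K : Set ℝ // K ⊆ B ∧ IsCompact K} := ⟨⟨∅, by simp⟩⟩
  refine ENNReal.iSup_add_iSup_le fun K L => ?_
  calc volume K.1 + volume L.1 ≤ volume (insert a K.1) + volume (insert b L.1) := by
        gcongr <;> exact subset_insert _ _
    _ ≤ volume (insert a K.1 + insert b L.1) :=
      volume_add_volume_le_volume_add_of_isCompact (K.2.2.insert a) (L.2.2.insert b)
        (insert_nonempty _ _) (insert_nonempty _ _)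
    _ ≤ volume (A + B) := by
      gcongr
      exacts [insert_subset ha K.2.1, insert_subset hb L.2.1]

theorem volume_setOf_pos_ofReal_lt (c : ℝ≥0∞) :
    volume {r : ℝ | 0 < r ∧ ENNReal.ofReal r < c} = c := by
  induction c with
  | top =>
    simp only [ENNReal.ofReal_lt_top, and_true]
    exact Real.volume_Ioi
  | coe c =>
    have h_eq : {r : ℝ | 0 < r ∧ ENNReal.ofReal r < c} = Ioo 0 (c : ℝ) := by
      ext r
      simp only [mem_ofPred_eq, mem_Ioo, and_congr_right_iff]
      intro hr
      rw [← ENNReal.ofReal_coe_nnreal, ENNReal.ofReal_lt_ofReal_iff_of_nonneg hr.le]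
    simp [h_eq]

theorem measurable_measure_setOf_ofReal_lt {α : Type*} [MeasurableSpace α] (μ : Measure α)
    (f : α → ℝ≥0∞) : Measurable fun r : ℝ => μ {x | ENNReal.ofReal r < f x} :=
  Antitone.measurable fun _ _ hrs =>
    measure_mono fun _ hx => (ENNReal.ofReal_le_ofReal hrs).trans_lt hx

theorem lintegral_eq_setLIntegral_measure_ofReal_lt {α : Type*} [MeasurableSpace α]
    (μ : Measure α) [SFinite μ] {f : α → ℝ≥0∞} (hf : Measurable f) :
    ∫⁻ x, f x ∂μ = ∫⁻ r in Ioi (0 : ℝ), μ {x | ENNReal.ofReal r < f x} := by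
  set S : Set (ℝ × α) := {p | 0 < p.1 ∧ ENNReal.ofReal p.1 < f p.2} with hS_def
  have hS : MeasurableSet S :=
    (measurableSet_lt measurable_const measurable_fst).inter
      (measurableSet_lt measurable_fst.ennreal_ofReal (hf.comp measurable_snd))
  calc ∫⁻ x, f x ∂μ = ∫⁻ x, volume ((fun r : ℝ => (r, x)) ⁻¹' S) ∂μ :=
      lintegral_congr fun x => (volume_setOf_pos_ofReal_lt (f x)).symm
    _ = (volume.prod μ) S := (Measure.prod_apply_symm hS).symm
    _ = ∫⁻ r : ℝ, μ (Prod.mk r ⁻¹' S) := Measure.prod_apply hS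
    _ = ∫⁻ r in Ioi (0 : ℝ), μ {x | ENNReal.ofReal r < f x} := by
      rw [← lintegral_indicator measurableSet_Ioi]
      refine lintegral_congr fun r => ?_
      by_cases hr : 0 < r <;> simp [hS_def, hr]

theorem lintegral_eq_setLIntegral_Ioo_measure_ofReal_lt {α : Type*} [MeasurableSpace α]
    (μ : Measure α) [SFinite μ] {f : α → ℝ≥0∞} (hf : Measurable f) (hf_le : ∀ x, f x ≤ 1) :
    ∫⁻ x, f x ∂μ = ∫⁻ r in Ioo (0 : ℝ) 1, μ {x | ENNReal.ofReal r < f x} := by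
  have h_disj : Disjoint (Ioo (0 : ℝ) 1) (Ici 1) :=
    disjoint_left.2 fun _ hx hx' => not_lt.2 hx' hx.2
  have h_empty {r : ℝ} (hr : 1 ≤ r) : {x | ENNReal.ofReal r < f x} = ∅ :=
    eq_empty_of_forall_notMem fun x hx =>
      absurd (hx.trans_le (hf_le x)) (not_lt.2 (ENNReal.one_le_ofReal.2 hr))
  rw [lintegral_eq_setLIntegral_measure_ofReal_lt μ hf, ← Ioo_union_Ici_eq_Ioi zero_lt_one,
    lintegral_union measurableSet_Ici h_disj,
    setLIntegral_congr_fun (g := fun _ => 0) measurableSet_Ici fun r hr => by simp [h_empty hr],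
    lintegral_zero, add_zero]

variable {a b : ℝ}

theorem rpow_mul_rpow_le_ofReal_mul_add (ha : 0 < a) (hb : 0 < b) (hab : a + b = 1)
    (x y : ℝ≥0∞) : x ^ a * y ^ b ≤ ENNReal.ofReal a * x + ENNReal.ofReal b * y := by
  induction x with
  | top => simp [ENNReal.mul_top, ha]
  | coe x =>
    induction y with
    | top => simp [ENNReal.mul_top, hb]
    | coe y =>
      lift a to NNReal using ha.le
      lift b to NNReal using hb.le
      rw [← ENNReal.coe_rpow_of_nonneg _ ha.le, ← ENNReal.coe_rpow_of_nonneg _ hb.le]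
      simp only [ENNReal.ofReal_coe_nnreal]
      exact_mod_cast NNReal.geom_mean_le_arith_mean2_weighted a b x y (by exact_mod_cast hab)

theorem ofReal_mul_volume_add_le {A B : Set ℝ} (ha : 0 < a) (hb : 0 < b) (hA : MeasurableSet A)
    (hB : MeasurableSet B) (hA_ne : A.Nonempty) (hB_ne : B.Nonempty) :
    ENNReal.ofReal a * volume A + ENNReal.ofReal b * volume B ≤ volume (a • A + b • B) := by
  have h_smul {c : ℝ} (hc : 0 < c) (s : Set ℝ) :
      ENNReal.ofReal c * volume s = volume (c • s) := by
    simp [Measure.addHaar_smul_of_nonneg volume hc.le]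
  rw [h_smul ha, h_smul hb]
  exact volume_add_volume_le_volume_add (hA.const_smul₀ a) (hB.const_smul₀ b)
    (hA_ne.smul_set) (hB_ne.smul_set)

theorem prekopa_leindler_of_iSup_eq_one (ha : 0 < a) (hb : 0 < b) (hab : a + b = 1)
    {u v m : ℝ → ℝ≥0∞} (hu : Measurable u) (hv : Measurable v) (hm : Measurable m)
    (hu_sup : ⨆ x, u x = 1) (hv_sup : ⨆ x, v x = 1)
    (h : ∀ x y, u x ^ a * v y ^ b ≤ m (a * x + b * y)) :
    (∫⁻ x, u x) ^ a * (∫⁻ x, v x) ^ b ≤ ∫⁻ x, m x := by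
  have h_ne {f : ℝ → ℝ≥0∞} (hf_sup : ⨆ x, f x = 1) {r : ℝ} (hr : r < 1) :
      {x | ENNReal.ofReal r < f x}.Nonempty := by
    obtain ⟨x, hx⟩ := lt_iSup_iff.1 (hf_sup ▸ ENNReal.ofReal_lt_one.2 hr)
    exact ⟨x, hx⟩
  have h_subset (r : ℝ) : a • {x | ENNReal.ofReal r < u x} + b • {x | ENNReal.ofReal r < v x} ⊆
      {x | ENNReal.ofReal r < m x} := by
    rintro _ ⟨_, ⟨x, hx, rfl⟩, _, ⟨y, hy, rfl⟩, rfl⟩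
    refine lt_of_lt_of_le ?_ (h x y)
    calc ENNReal.ofReal r = ENNReal.ofReal r ^ a * ENNReal.ofReal r ^ b := by
          rw [← ENNReal.rpow_add_of_nonneg _ _ ha.le hb.le, hab, ENNReal.rpow_one]
      _ < u x ^ a * v y ^ b :=
          ENNReal.mul_lt_mul (ENNReal.rpow_lt_rpow hx ha) (ENNReal.rpow_lt_rpow hy hb)
  calc (∫⁻ x, u x) ^ a * (∫⁻ x, v x) ^ b
      ≤ ENNReal.ofReal a * (∫⁻ x, u x) + ENNReal.ofReal b * ∫⁻ x, v x :=
        rpow_mul_rpow_le_ofReal_mul_add ha hb hab _ _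
    _ = ∫⁻ r in Ioo (0 : ℝ) 1, (ENNReal.ofReal a * volume {x | ENNReal.ofReal r < u x} +
          ENNReal.ofReal b * volume {x | ENNReal.ofReal r < v x}) := by
        have h_meas (f : ℝ → ℝ≥0∞) := measurable_measure_setOf_ofReal_lt volume f
        rw [lintegral_eq_setLIntegral_Ioo_measure_ofReal_lt _ hu (fun x => hu_sup ▸ le_iSup u x),
          lintegral_eq_setLIntegral_Ioo_measure_ofReal_lt _ hv (fun x => hv_sup ▸ le_iSup v x),
          lintegral_add_left ((h_meas u).const_mul _),
          lintegral_const_mul _ (h_meas u), lintegral_const_mul _ (h_meas v)]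
    _ ≤ ∫⁻ r in Ioo (0 : ℝ) 1, volume {x | ENNReal.ofReal r < m x} :=
        setLIntegral_mono (measurable_measure_setOf_ofReal_lt volume m) fun r hr =>
          (ofReal_mul_volume_add_le ha hb (measurableSet_lt measurable_const hu)
            (measurableSet_lt measurable_const hv) (h_ne hu_sup hr.2) (h_ne hv_sup hr.2)).trans
            (measure_mono (h_subset r))
    _ ≤ ∫⁻ x, m x := by
        rw [lintegral_eq_setLIntegral_measure_ofReal_lt _ hm]
        exact lintegral_mono_set Ioo_subset_Ioi_self

theorem prekopa_leindler_of_bounded (ha : 0 < a) (hb : 0 < b) (hab : a + b = 1)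
    {u v m : ℝ → ℝ≥0∞} (hu : Measurable u) (hv : Measurable v) (hm : Measurable m)
    (hu_sup : ⨆ x, u x ≠ ⊤) (hv_sup : ⨆ x, v x ≠ ⊤)
    (h : ∀ x y, u x ^ a * v y ^ b ≤ m (a * x + b * y)) :
    (∫⁻ x, u x) ^ a * (∫⁻ x, v x) ^ b ≤ ∫⁻ x, m x := by
  set A := ⨆ x, u x
  set B := ⨆ x, v x
  rcases eq_or_ne A 0 with hA0 | hA0
  · simp [ENNReal.iSup_eq_zero.1 hA0, ha]
  rcases eq_or_ne B 0 with hB0 | hB0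
  · simp [ENNReal.iSup_eq_zero.1 hB0, hb]
  have hA_top : A ^ a ≠ ⊤ := ENNReal.rpow_ne_top_of_nonneg ha.le hu_sup
  have hB_top : B ^ b ≠ ⊤ := ENNReal.rpow_ne_top_of_nonneg hb.le hv_sup
  have h_ne_top : A ^ a * B ^ b ≠ ⊤ := ENNReal.mul_ne_top hA_top hB_top
  have h_ne_zero : A ^ a * B ^ b ≠ 0 :=
    mul_ne_zero (ENNReal.rpow_pos (pos_iff_ne_zero.2 hA0) hu_sup).ne'
      (ENNReal.rpow_pos (pos_iff_ne_zero.2 hB0) hv_sup).ne'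
  have h_div (c d : ℝ≥0∞) : (c / A) ^ a * (d / B) ^ b = c ^ a * d ^ b / (A ^ a * B ^ b) := by
    rw [ENNReal.div_rpow_of_nonneg _ _ ha.le, ENNReal.div_rpow_of_nonneg _ _ hb.le,
      ENNReal.mul_div_mul_comm]
    exacts [.inr hB_top, .inl hA_top]
  have h_normalized := prekopa_leindler_of_iSup_eq_one ha hb hab (hu.div_const A) (hv.div_const B)
    (hm.div_const (A ^ a * B ^ b)) (by rw [← ENNReal.iSup_div, ENNReal.div_self hA0 hu_sup])
    (by rw [← ENNReal.iSup_div, ENNReal.div_self hB0 hv_sup])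
    fun x y => (h_div _ _).trans_le (ENNReal.div_le_div_right (h x y) _)
  simp only [div_eq_mul_inv, lintegral_mul_const _ hu, lintegral_mul_const _ hv,
    lintegral_mul_const _ hm] at h_normalized
  simp only [← div_eq_mul_inv, h_div] at h_normalized
  rwa [ENNReal.div_le_iff h_ne_zero h_ne_top, ENNReal.div_mul_cancel h_ne_zero h_ne_top]
    at h_normalized

theorem lintegral_eq_iSup_lintegral_min_natCast {α : Type*} [MeasurableSpace α] (μ : Measure α)
    {f : α → ℝ≥0∞} (hf : Measurable f) :
    ∫⁻ x, f x ∂μ = ⨆ N : ℕ, ∫⁻ x, min (f x) N ∂μ := by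
  rw [← lintegral_iSup (fun N => hf.min measurable_const)
    fun i j hij x => min_le_min_left _ (by exact_mod_cast hij)]
  simp only [← inf_iSup_eq, ENNReal.iSup_natCast, inf_top_eq]

theorem prekopa_leindler_real (ha : 0 < a) (hb : 0 < b) (hab : a + b = 1)
    {u v m : ℝ → ℝ≥0∞} (hu : Measurable u) (hv : Measurable v) (hm : Measurable m)
    (h : ∀ x y, u x ^ a * v y ^ b ≤ m (a * x + b * y)) :
    (∫⁻ x, u x) ^ a * (∫⁻ x, v x) ^ b ≤ ∫⁻ x, m x := by
  have h_mono (f : ℝ → ℝ≥0∞) {c : ℝ} (hc : 0 < c) :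
      Monotone fun N : ℕ => (∫⁻ x, min (f x) N) ^ c := fun i j hij => by
    dsimp only
    gcongr
  have h_iSup {f : ℝ → ℝ≥0∞} (hf : Measurable f) {c : ℝ} (hc : 0 < c) :
      (∫⁻ x, f x) ^ c = ⨆ N : ℕ, (∫⁻ x, min (f x) N) ^ c := by
    rw [lintegral_eq_iSup_lintegral_min_natCast _ hf]
    exact (ENNReal.orderIsoRpow c hc).map_iSup _
  have h_sup_ne_top (f : ℝ → ℝ≥0∞) (N : ℕ) : ⨆ x, min (f x) N ≠ ⊤ :=
    ne_top_of_le_ne_top (ENNReal.natCast_ne_top N) (iSup_le fun _ => min_le_right _ _)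
  have h_truncated (N : ℕ) :
      (∫⁻ x, min (u x) N) ^ a * (∫⁻ x, min (v x) N) ^ b ≤ ∫⁻ x, m x := by
    refine prekopa_leindler_of_bounded ha hb hab (hu.min measurable_const)
      (hv.min measurable_const) hm (h_sup_ne_top u N) (h_sup_ne_top v N) fun x y => ?_
    refine le_trans ?_ (h x y)
    gcongr <;> exact min_le_left _ _
  simp only [h_iSup hu ha, h_iSup hv hb, ENNReal.iSup_mul, ENNReal.mul_iSup]
  refine iSup₂_le fun j i => le_trans ?_ (h_truncated (max i j))
  exact mul_le_mul' (h_mono u ha (le_max_left i j)) (h_mono v hb (le_max_right i j))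

theorem prekopa_leindler_pi (ha : 0 < a) (hb : 0 < b) (hab : a + b = 1) (n : ℕ)
    {u v m : (Fin n → ℝ) → ℝ≥0∞} (hu : Measurable u) (hv : Measurable v) (hm : Measurable m)
    (h : ∀ x y, u x ^ a * v y ^ b ≤ m (a • x + b • y)) :
    (∫⁻ x, u x) ^ a * (∫⁻ x, v x) ^ b ≤ ∫⁻ x, m x := by
  induction n with
  | zero =>
    simp only [volume_pi]
    simpa [Subsingleton.elim _ (isEmptyElim : Fin 0 → ℝ)] using
      h (isEmptyElim : Fin 0 → ℝ) (isEmptyElim : Fin 0 → ℝ)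
  | succ n ih =>
    let e := (MeasurableEquiv.piFinSuccAbove (fun _ : Fin (n + 1) => ℝ) 0).symm
    have he : MeasurePreserving e volume volume :=
      (volume_preserving_piFinSuccAbove (fun _ : Fin (n + 1) => ℝ) 0).symm
    have he_combo (s t : ℝ) (x y : Fin n → ℝ) :
        a • e (s, x) + b • e (t, y) = e (a * s + b * t, a • x + b • y) := by
      ext i
      refine Fin.cases ?_ (fun j => ?_) i <;> simp [e]
    have h_fubini {f : (Fin (n + 1) → ℝ) → ℝ≥0∞} (hf : Measurable f) :
        ∫⁻ x, f x = ∫⁻ s : ℝ, ∫⁻ y : Fin n → ℝ, f (e (s, y)) := by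
      rw [← he.lintegral_comp hf, Measure.volume_eq_prod]
      exact lintegral_prod _ (hf.comp e.measurable).aemeasurable
    have h_meas {f : (Fin (n + 1) → ℝ) → ℝ≥0∞} (hf : Measurable f) :
        Measurable fun s : ℝ => ∫⁻ y : Fin n → ℝ, f (e (s, y)) :=
      (hf.comp e.measurable).lintegral_prod_right'
    have h_section {f : (Fin (n + 1) → ℝ) → ℝ≥0∞} (hf : Measurable f) (s : ℝ) :
        Measurable fun y : Fin n → ℝ => f (e (s, y)) :=
      hf.comp (e.measurable.comp measurable_prodMk_left)
    rw [h_fubini hu, h_fubini hv, h_fubini hm]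
    refine prekopa_leindler_real ha hb hab (h_meas hu) (h_meas hv) (h_meas hm) fun s t => ?_
    refine ih (h_section hu s) (h_section hv t) (h_section hm _) fun x y => ?_
    rw [← he_combo]
    exact h _ _

theorem prekopa_leindler {E : Type*} [NormedAddCommGroup E] [InnerProductSpace ℝ E]
    [FiniteDimensional ℝ E] [MeasurableSpace E] [BorelSpace E] (ha : 0 < a) (hb : 0 < b)
    (hab : a + b = 1) {u v m : E → ℝ≥0∞} (hu : Measurable u) (hv : Measurable v)
    (hm : Measurable m) (h : ∀ x y, u x ^ a * v y ^ b ≤ m (a • x + b • y)) :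
    (∫⁻ x, u x) ^ a * (∫⁻ x, v x) ^ b ≤ ∫⁻ x, m x := by
  let B := stdOrthonormalBasis ℝ E
  let e (y : Fin (Module.finrank ℝ E) → ℝ) : E := B.repr.symm (WithLp.toLp 2 y)
  have he : MeasurePreserving e volume volume :=
    B.measurePreserving_repr_symm.comp (PiLp.volume_preserving_toLp _)
  have he_combo (x y : Fin (Module.finrank ℝ E) → ℝ) : e (a • x + b • y) = a • e x + b • e y := by
    simp [e]
  rw [← he.lintegral_comp hu, ← he.lintegral_comp hv, ← he.lintegral_comp hm]
  refine prekopa_leindler_pi ha hb hab _ (hu.comp he.measurable) (hv.comp he.measurable)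
    (hm.comp he.measurable) fun x y => ?_
  rw [he_combo]
  exact h _ _

end PrekopaLeindler

section PropertyTau

variable {F : Type*} [NormedAddCommGroup F] [MeasurableSpace F]

/-- Maurey's property `(τ)` for the quadratic cost `κ / 4 * ‖x - y‖ ^ 2`. -/
def HasPropertyTau (μ : Measure F) (κ : ℝ) : Prop :=
  ∀ φ ψ : F → ℝ, Measurable φ → Measurable ψ → (∀ x y, φ x + ψ y ≤ κ / 4 * ‖x - y‖ ^ 2) →
    (∫⁻ x, ENNReal.ofReal (Real.exp (φ x)) ∂μ) * (∫⁻ x, ENNReal.ofReal (Real.exp (ψ x)) ∂μ) ≤ 1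

theorem HasPropertyTau.integral_exp_mul_integral_exp_le {μ : Measure F} {κ : ℝ}
    (hμ : HasPropertyTau μ κ) {φ ψ : F → ℝ}
    (hφ : Measurable φ) (hψ : Measurable ψ) (hφ_int : Integrable (fun x => Real.exp (φ x)) μ)
    (hψ_int : Integrable (fun x => Real.exp (ψ x)) μ)
    (h : ∀ x y, φ x + ψ y ≤ κ / 4 * ‖x - y‖ ^ 2) :
    (∫ x, Real.exp (φ x) ∂μ) * ∫ x, Real.exp (ψ x) ∂μ ≤ 1 := by
  have h_nonneg (χ : F → ℝ) : 0 ≤ᵐ[μ] fun x => Real.exp (χ x) :=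
    .of_forall fun x => (Real.exp_pos _).le
  have h_tau := hμ φ ψ hφ hψ h
  rwa [← ofReal_integral_eq_lintegral_ofReal hφ_int (h_nonneg φ),
    ← ofReal_integral_eq_lintegral_ofReal hψ_int (h_nonneg ψ),
    ← ENNReal.ofReal_mul (integral_nonneg_of_ae (h_nonneg φ)), ENNReal.ofReal_le_one] at h_tau

end PropertyTau

variable {E : Type*} [NormedAddCommGroup E] [InnerProductSpace ℝ E]

/-- A nonnegative function `ρ` whose logarithm is strongly concave with modulus `κ` where `ρ` is
positive; zeros of `ρ` play the role of points where `log ρ = -∞`. Negative `κ` is allowed. -/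
structure IsStronglyLogConcave (ρ : E → ℝ) (κ : ℝ) : Prop where
  nonneg : ∀ x, 0 ≤ ρ x
  strongConcaveOn_log : StrongConcaveOn {x | 0 < ρ x} κ fun x => Real.log (ρ x)

section StronglyLogConcave

theorem exists_le_add_mul_norm_of_concaveOn {F : Type*} [NormedAddCommGroup F] [NormedSpace ℝ F]
    {s : Set F} {f : F → ℝ} {x₀ : F} (hf : ConcaveOn ℝ s f) (hs : s ∈ 𝓝 x₀)
    (hf_cont : ContinuousAt f x₀) : ∃ A B : ℝ, ∀ y ∈ s, f y ≤ A + B * ‖y‖ := by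
  obtain ⟨r, hr, h_ball⟩ := Metric.nhds_basis_closedBall.mem_iff.1
    (inter_mem hs (hf_cont.eventually_const_le (sub_one_lt (f x₀))))
  refine ⟨f x₀ + (1 + ‖x₀‖) / r, 1 / r, fun y hy => ?_⟩
  set R := ‖y - x₀‖
  have hR : 0 ≤ R := norm_nonneg _
  -- `x₀` is a convex combination of `y` and a point `z` of the ball opposite to `y`.
  set z := x₀ - (r / (1 + R)) • (y - x₀)
  have hz : z ∈ Metric.closedBall x₀ r := by
    rw [mem_closedBall_iff_norm, sub_sub_cancel_left, norm_neg, norm_smul,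
      Real.norm_of_nonneg (by positivity), div_mul_eq_mul_div, div_le_iff₀ (by positivity)]
    nlinarith
  have h_combo : (r / (1 + R + r)) • y + ((1 + R) / (1 + R + r)) • z = x₀ := by
    simp only [z]
    match_scalars <;> field_simp <;> ring
  have h_concave := hf.2 hy (h_ball hz).1 (by positivity : 0 ≤ r / (1 + R + r))
    (by positivity : 0 ≤ (1 + R) / (1 + R + r)) (by field_simp; ring)
  have hfz : f x₀ - 1 ≤ f z := (h_ball hz).2
  rw [h_combo, smul_eq_mul, smul_eq_mul, div_mul_eq_mul_div, div_mul_eq_mul_div, ← add_div,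
    div_le_iff₀ (by positivity)] at h_concave
  have hR_le : R ≤ ‖y‖ + ‖x₀‖ := norm_sub_le y x₀
  have h_mul : r * f y ≤ r * f x₀ + (1 + ‖x₀‖ + ‖y‖) := by nlinarith
  have h_div : f x₀ + (1 + ‖x₀‖) / r + 1 / r * ‖y‖ = (r * f x₀ + (1 + ‖x₀‖ + ‖y‖)) / r := by
    field_simp
    ring
  rwa [h_div, le_div_iff₀' hr]

theorem integrable_exp_neg_mul_sq_norm [FiniteDimensional ℝ E] [MeasurableSpace E] [BorelSpace E]
    {c : ℝ} (hc : 0 < c) : Integrable fun x : E => Real.exp (-c * ‖x‖ ^ 2) := by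
  have h_gaussian := (GaussianFourier.integrable_cexp_neg_mul_sq_norm_add (V := E) (b := c)
    (by simpa using hc) 0 0).norm
  simpa [Complex.norm_exp, ← Complex.ofReal_pow] using h_gaussian

namespace IsStronglyLogConcave

variable {ρ : E → ℝ} {κ : ℝ}

theorem rpow_mul_rpow_mul_exp_le (hρ : IsStronglyLogConcave ρ κ) {a b : ℝ} (ha : 0 < a)
    (hb : 0 < b) (hab : a + b = 1) (x y : E) :
    ρ x ^ a * ρ y ^ b * Real.exp (a * b * (κ / 2 * ‖x - y‖ ^ 2)) ≤ ρ (a • x + b • y) := by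
  rcases (hρ.nonneg x).eq_or_lt with hx | hx
  · simpa [← hx, Real.zero_rpow ha.ne'] using hρ.nonneg (a • x + b • y)
  rcases (hρ.nonneg y).eq_or_lt with hy | hy
  · simpa [← hy, Real.zero_rpow hb.ne'] using hρ.nonneg (a • x + b • y)
  have h_pos : 0 < ρ (a • x + b • y) := hρ.strongConcaveOn_log.1 hx hy ha.le hb.le hab
  have h_log := hρ.strongConcaveOn_log.2 hx hy ha.le hb.le hab
  simp only [smul_eq_mul] at h_log
  rw [← Real.log_le_log_iff (by positivity) h_pos, Real.log_mul (by positivity) (by positivity),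
    Real.log_mul (by positivity) (by positivity), Real.log_rpow hx, Real.log_rpow hy,
    Real.log_exp]
  exact h_log

theorem mul_exp_neg_sq_norm (hρ : IsStronglyLogConcave ρ κ) (c : ℝ) :
    IsStronglyLogConcave (fun x => ρ x * Real.exp (-(c / 2 * ‖x‖ ^ 2))) (κ + c) where
  nonneg x := mul_nonneg (hρ.nonneg x) (Real.exp_pos _).le
  strongConcaveOn_log := by
    have h_concave := strongConcaveOn_iff_convex.1 hρ.strongConcaveOn_log
    have h_support : {x | 0 < ρ x * Real.exp (-(c / 2 * ‖x‖ ^ 2))} = {x | 0 < ρ x} := by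
      simp [Real.exp_pos]
    rw [h_support, strongConcaveOn_iff_convex]
    refine h_concave.congr fun x hx => ?_
    rw [Real.log_mul hx.ne' (Real.exp_pos _).ne', Real.log_exp]
    ring

section FiniteDimensional

variable [FiniteDimensional ℝ E]

theorem continuousOn_log_add_sq_norm (hρ : IsStronglyLogConcave ρ κ)
    (hρ_open : IsOpen {x | 0 < ρ x}) :
    ContinuousOn (fun x => Real.log (ρ x) + κ / 2 * ‖x‖ ^ 2) {x | 0 < ρ x} :=
  (strongConcaveOn_iff_convex.1 hρ.strongConcaveOn_log).continuousOn hρ_open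

variable [MeasurableSpace E] [BorelSpace E]

theorem measurable (hρ : IsStronglyLogConcave ρ κ) (hρ_open : IsOpen {x | 0 < ρ x}) :
    Measurable ρ := by
  classical
  have h_cont : ContinuousOn ρ {x | 0 < ρ x} := by
    refine ((hρ.continuousOn_log_add_sq_norm hρ_open).sub
      (g := fun x => κ / 2 * ‖x‖ ^ 2) (by fun_prop)).rexp.congr fun x hx => ?_
    simp [Real.exp_log hx]
  have h_eq : ρ = {x | 0 < ρ x}.piecewise ρ 0 := by
    ext x
    by_cases hx : 0 < ρ x
    · simp [hx]
    · simpa [hx] using le_antisymm (not_lt.1 hx) (hρ.nonneg x)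
  rw [h_eq]
  exact h_cont.measurable_piecewise continuousOn_const hρ_open.measurableSet

theorem integrable (hρ : IsStronglyLogConcave ρ κ) (hρ_open : IsOpen {x | 0 < ρ x})
    (hκ : 0 < κ) : Integrable ρ := by
  rcases {x | 0 < ρ x}.eq_empty_or_nonempty with h_empty | ⟨x₀, hx₀⟩
  · have h_zero : ρ = 0 := by
      ext x
      exact le_antisymm (not_lt.1 fun hx => h_empty.subset hx) (hρ.nonneg x)
    simp [h_zero]
  have h_nhds := hρ_open.mem_nhds hx₀
  obtain ⟨A, B, hAB⟩ := exists_le_add_mul_norm_of_concaveOn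
    (strongConcaveOn_iff_convex.1 hρ.strongConcaveOn_log) h_nhds
      ((hρ.continuousOn_log_add_sq_norm hρ_open).continuousAt h_nhds)
  have h_bound (x : E) : ρ x ≤ Real.exp (A + B ^ 2 / κ) * Real.exp (-(κ / 4) * ‖x‖ ^ 2) := by
    rcases (hρ.nonneg x).eq_or_lt with hx | hx
    · rw [← hx]
      positivity
    have h_young : B * ‖x‖ ≤ B ^ 2 / κ + κ / 4 * ‖x‖ ^ 2 := by
      have h_sq : B ^ 2 / κ + κ / 4 * ‖x‖ ^ 2 - B * ‖x‖ = (B - κ / 2 * ‖x‖) ^ 2 / κ := by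
        field_simp
        ring
      linarith [div_nonneg (sq_nonneg (B - κ / 2 * ‖x‖)) hκ.le]
    rw [← Real.exp_add, ← Real.log_le_iff_le_exp hx]
    linarith [hAB x hx]
  exact ((integrable_exp_neg_mul_sq_norm (by positivity)).const_mul _).mono'
    (hρ.measurable hρ_open).aestronglyMeasurable
    (.of_forall fun x => (Real.norm_of_nonneg (hρ.nonneg x)).trans_le (h_bound x))

end FiniteDimensional

end IsStronglyLogConcave

end StronglyLogConcave

section Taylor

variable {F : Type*} [NormedAddCommGroup F] [NormedSpace ℝ F] {u : F → ℝ}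

theorem sub_le_norm_fderiv_mul_add_of_lipschitzWith {C : NNReal} (hu : Differentiable ℝ u)
    (hC : LipschitzWith C (fderiv ℝ u)) (x y : F) :
    u x - u y ≤ ‖fderiv ℝ u x‖ * ‖x - y‖ + C * ‖x - y‖ ^ 2 := by
  have h_remainder : ‖u x - u y - fderiv ℝ u x (x - y)‖ ≤ C * ‖x - y‖ * ‖x - y‖ := by
    refine (convex_segment x y).norm_image_sub_le_of_norm_hasFDerivWithin_le'
      (fun z _ => (hu z).hasFDerivAt.hasFDerivWithinAt) (fun z hz => ?_)
      (right_mem_segment ℝ x y) (left_mem_segment ℝ x y)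
    refine (hC.norm_sub_le z x).trans ?_
    rw [norm_sub_rev x y]
    gcongr
    exact norm_sub_le_of_mem_segment hz
  have h_linear : fderiv ℝ u x (x - y) ≤ ‖fderiv ℝ u x‖ * ‖x - y‖ :=
    (le_abs_self _).trans ((fderiv ℝ u x).le_opNorm _)
  linarith [(abs_le.1 h_remainder).2]

theorem mul_sub_sub_mul_sq_norm_fderiv_le {κ t : ℝ} {C : NNReal} (hu : Differentiable ℝ u)
    (hC : LipschitzWith C (fderiv ℝ u)) (ht : 0 ≤ t) (hκ : 4 * C * t < κ) (x y : F) :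
    t * (u x - u y) - t ^ 2 * (κ - 4 * C * t)⁻¹ * ‖fderiv ℝ u x‖ ^ 2 ≤ κ / 4 * ‖x - y‖ ^ 2 := by
  set D := κ - 4 * C * t with hD_def
  have hD : 0 < D := sub_pos.2 hκ
  have h_taylor := mul_le_mul_of_nonneg_left
    (sub_le_norm_fderiv_mul_add_of_lipschitzWith hu hC x y) ht
  have h_young : t * (‖fderiv ℝ u x‖ * ‖x - y‖) ≤
      t ^ 2 * D⁻¹ * ‖fderiv ℝ u x‖ ^ 2 + D / 4 * ‖x - y‖ ^ 2 := by
    have h_sq : t ^ 2 * D⁻¹ * ‖fderiv ℝ u x‖ ^ 2 + D / 4 * ‖x - y‖ ^ 2 -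
        t * (‖fderiv ℝ u x‖ * ‖x - y‖) =
          (2 * t * ‖fderiv ℝ u x‖ - D * ‖x - y‖) ^ 2 / (4 * D) := by
      field_simp
      ring
    linarith [div_nonneg (sq_nonneg (2 * t * ‖fderiv ℝ u x‖ - D * ‖x - y‖))
      (by positivity : 0 ≤ 4 * D)]
  linear_combination h_taylor + h_young + ‖x - y‖ ^ 2 / 4 * hD_def

end Taylor

theorem norm_gradient_eq_norm_fderiv [CompleteSpace E] (u : E → ℝ) (x : E) :
    ‖gradient u x‖ = ‖fderiv ℝ u x‖ := by
  simp [gradient]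

theorem memLp_gradient [CompleteSpace E] [MeasurableSpace E] [BorelSpace E] {μ : Measure E}
    [IsFiniteMeasureOnCompacts μ] {u : E → ℝ} (hu : ContDiff ℝ 1 u) (hu_supp : HasCompactSupport u)
    (p : ℝ≥0∞) : MemLp (gradient u) p μ := by
  have h_cont : Continuous (gradient u) :=
    (InnerProductSpace.toDual ℝ E).symm.continuous.comp (hu.continuous_fderiv one_ne_zero)
  exact h_cont.memLp_of_hasCompactSupport <|
    (hu_supp.fderiv ℝ).comp_left (map_zero (InnerProductSpace.toDual ℝ E).symm)

section PropertyTauOfDensity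

variable [FiniteDimensional ℝ E] [MeasurableSpace E] [BorelSpace E] {ρ : E → ℝ} {κ : ℝ}

theorem IsStronglyLogConcave.lintegral_exp_rpow_mul_le (hρ : IsStronglyLogConcave ρ κ)
    (hρ_meas : Measurable ρ) {a b : ℝ} (ha : 0 < a) (hb : 0 < b) (hab : a + b = 1)
    {φ ψ : E → ℝ} (hφ : Measurable φ) (hψ : Measurable ψ)
    (h : ∀ x y, a * φ x + b * ψ y ≤ a * b * (κ / 2 * ‖x - y‖ ^ 2)) :
    (∫⁻ x, ENNReal.ofReal (ρ x * Real.exp (φ x))) ^ a *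
      (∫⁻ x, ENNReal.ofReal (ρ x * Real.exp (ψ x))) ^ b ≤ ∫⁻ x, ENNReal.ofReal (ρ x) := by
  refine prekopa_leindler ha hb hab (by fun_prop) (by fun_prop) (by fun_prop) fun x y => ?_
  have hx := hρ.nonneg x
  have hy := hρ.nonneg y
  rw [ENNReal.ofReal_rpow_of_nonneg (by positivity) ha.le,
    ENNReal.ofReal_rpow_of_nonneg (by positivity) hb.le, ← ENNReal.ofReal_mul (by positivity)]
  refine ENNReal.ofReal_le_ofReal (le_trans ?_ (hρ.rpow_mul_rpow_mul_exp_le ha hb hab x y))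
  calc (ρ x * Real.exp (φ x)) ^ a * (ρ y * Real.exp (ψ y)) ^ b
      = ρ x ^ a * ρ y ^ b * Real.exp (a * φ x + b * ψ y) := by
        rw [Real.mul_rpow hx (Real.exp_pos _).le, Real.mul_rpow hy (Real.exp_pos _).le,
          ← Real.exp_mul, ← Real.exp_mul, Real.exp_add, mul_comm a, mul_comm b]
        ring
    _ ≤ _ := by
        gcongr
        exact h x y

theorem IsStronglyLogConcave.hasPropertyTau (hρ : IsStronglyLogConcave ρ κ)
    (hρ_meas : Measurable ρ) {c : ℝ≥0∞}
    [IsProbabilityMeasure (c • volume.withDensity fun x => ENNReal.ofReal (ρ x))] :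
    HasPropertyTau (c • volume.withDensity fun x => ENNReal.ofReal (ρ x)) κ := by
  intro φ ψ hφ hψ h
  have h_density {χ : E → ℝ} (hχ : Measurable χ) :
      ∫⁻ x, ENNReal.ofReal (Real.exp (χ x)) ∂(c • volume.withDensity fun x => ENNReal.ofReal (ρ x))
        = c * ∫⁻ x, ENNReal.ofReal (ρ x * Real.exp (χ x)) := by
    rw [lintegral_smul_measure, lintegral_withDensity_eq_lintegral_mul _ (by fun_prop)
      (by fun_prop), smul_eq_mul]
    simp [ENNReal.ofReal_mul (hρ.nonneg _)]
  have h_mass : c * ∫⁻ x, ENNReal.ofReal (ρ x) = 1 := by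
    simpa [-measure_univ] using
      measure_univ (μ := c • volume.withDensity fun x => ENNReal.ofReal (ρ x))
  have h_half : (0 : ℝ) < 1 / 2 := by norm_num
  have h_leindler := hρ.lintegral_exp_rpow_mul_le hρ_meas h_half h_half (by norm_num) hφ hψ
    fun x y => by linarith [h x y]
  have h_sq (t : ℝ≥0∞) : (t ^ (1 / 2 : ℝ)) ^ 2 = t := by
    rw [← ENNReal.rpow_natCast, ← ENNReal.rpow_mul]
    norm_num
  rw [h_density hφ, h_density hψ]
  set P := ∫⁻ x, ENNReal.ofReal (ρ x * Real.exp (φ x))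
  set Q := ∫⁻ x, ENNReal.ofReal (ρ x * Real.exp (ψ x))
  calc c * P * (c * Q) = (c * (P ^ (1 / 2 : ℝ) * Q ^ (1 / 2 : ℝ))) ^ 2 := by
        rw [mul_pow, mul_pow, h_sq, h_sq]
        ring
    _ ≤ (c * ∫⁻ x, ENNReal.ofReal (ρ x)) ^ 2 := by gcongr
    _ = 1 := by rw [h_mass, one_pow]

end PropertyTauOfDensity

section ExponentialMoments

theorem one_add_sq_div_two_le_cosh (x : ℝ) : 1 + x ^ 2 / 2 ≤ Real.cosh x := by
  have h_sinh : (x / 2) ^ 2 ≤ Real.sinh (x / 2) ^ 2 := by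
    rw [sq_le_sq, Real.abs_sinh]
    exact Real.self_le_sinh_iff.2 (abs_nonneg _)
  have h_double : Real.cosh x = 1 + 2 * Real.sinh (x / 2) ^ 2 := by
    rw [← mul_div_cancel₀ x two_ne_zero, Real.cosh_two_mul, Real.cosh_sq]
    ring_nf
  linarith

variable {α : Type*} [MeasurableSpace α] {μ : Measure α} {X : α → ℝ}

section

variable [IsFiniteMeasure μ]

theorem integrable_exp_of_le {M : ℝ} (hX : AEMeasurable X μ) (hM : ∀ x, X x ≤ M) :
    Integrable (fun x => Real.exp (X x)) μ := by
  simpa using integrable_exp_mul_of_le 1 M zero_le_one hX (.of_forall hM)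

theorem integral_exp_le_integral_exp_sub_add {Z : α → ℝ} {M : ℝ} (hX : AEMeasurable X μ)
    (hM : ∀ x, X x ≤ M) (hZ : Integrable Z μ) (hZ_nonneg : ∀ x, 0 ≤ Z x) :
    ∫ x, Real.exp (X x) ∂μ ≤ (∫ x, Real.exp (X x - Z x) ∂μ) + Real.exp M * ∫ x, Z x ∂μ := by
  have h_int_sub : Integrable (fun x => Real.exp (X x - Z x)) μ :=
    integrable_exp_of_le (hX.sub hZ.aemeasurable) fun x =>
      (sub_le_self _ (hZ_nonneg x)).trans (hM x)
  rw [← integral_const_mul, ← integral_add h_int_sub (hZ.const_mul _)]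
  refine integral_mono (integrable_exp_of_le hX hM) (h_int_sub.add (hZ.const_mul _)) fun x => ?_
  calc Real.exp (X x) = Real.exp (X x) * (1 - Z x) + Real.exp (X x) * Z x := by ring
    _ ≤ Real.exp (X x) * Real.exp (-Z x) + Real.exp M * Z x := by
        gcongr
        exacts [Real.one_sub_le_exp_neg _, hZ_nonneg x, hM x]
    _ = Real.exp (X x - Z x) + Real.exp M * Z x := by rw [← Real.exp_add, sub_eq_add_neg]

end

variable [IsProbabilityMeasure μ]

theorem integral_prod_sub_sq (hX : MemLp X 2 μ) :
    ∫ p, (X p.1 - X p.2) ^ 2 ∂(μ.prod μ) = 2 * Var[X; μ] := by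
  have h_int : Integrable X μ := hX.integrable one_le_two
  have h_sq : Integrable (fun x => X x ^ 2) μ := hX.integrable_sq
  have h_sum : Integrable (fun p => X p.1 ^ 2 + X p.2 ^ 2) (μ.prod μ) :=
    (h_sq.comp_fst μ).add (h_sq.comp_snd μ)
  calc ∫ p, (X p.1 - X p.2) ^ 2 ∂(μ.prod μ)
      = ∫ p, (X p.1 ^ 2 + X p.2 ^ 2 - 2 * (X p.1 * X p.2)) ∂(μ.prod μ) := by
        congr with p
        ring
    _ = 2 * Var[X; μ] := by
        rw [integral_sub h_sum ((h_int.mul_prod h_int).const_mul 2),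
          integral_add (h_sq.comp_fst μ) (h_sq.comp_snd μ), integral_const_mul,
          integral_prod_mul, integral_fun_fst fun x => X x ^ 2,
          integral_fun_snd fun x => X x ^ 2, variance_eq_sub hX]
        simp only [probReal_univ, one_smul, Pi.pow_apply]
        ring

theorem one_add_sq_mul_variance_le_mgf_mul_mgf_neg (hX : AEMeasurable X μ) {M : ℝ}
    (hM : ∀ᵐ x ∂μ, X x ∈ Icc (-M) M) (t : ℝ) :
    1 + t ^ 2 * Var[X; μ] ≤ mgf X μ t * mgf X μ (-t) := by
  have hX_memLp : MemLp X 2 μ := memLp_of_bounded hM hX.aestronglyMeasurable 2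
  have h_exp (s : ℝ) : Integrable (fun x => Real.exp (s * X x)) μ :=
    integrable_exp_mul_of_mem_Icc hX hM
  have h_exp_prod (s : ℝ) :
      Integrable (fun p : α × α => Real.exp (s * (X p.1 - X p.2))) (μ.prod μ) := by
    refine ((h_exp s).mul_prod (h_exp (-s))).congr (.of_forall fun p => ?_)
    simp only [← Real.exp_add]
    ring_nf
  have h_mgf (s : ℝ) : ∫ p, Real.exp (s * (X p.1 - X p.2)) ∂(μ.prod μ) =
      mgf X μ s * mgf X μ (-s) := by
    rw [mgf, mgf, ← integral_prod_mul]
    congr with p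
    rw [← Real.exp_add]
    ring_nf
  have h_sq : Integrable (fun p : α × α => (X p.1 - X p.2) ^ 2) (μ.prod μ) :=
    ((hX_memLp.comp_fst μ).sub (hX_memLp.comp_snd μ)).integrable_sq
  have h_cosh : Integrable (fun p : α × α => Real.cosh (t * (X p.1 - X p.2))) (μ.prod μ) := by
    simp only [Real.cosh_eq, ← neg_mul]
    exact ((h_exp_prod t).add (h_exp_prod (-t))).div_const 2
  -- Passing to an independent copy of `X` makes the exponent symmetric.
  calc 1 + t ^ 2 * Var[X; μ]
      = ∫ p, (1 + t ^ 2 / 2 * (X p.1 - X p.2) ^ 2) ∂(μ.prod μ) := by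
        rw [integral_add (integrable_const 1) (h_sq.const_mul _), integral_const_mul,
          integral_prod_sub_sq hX_memLp]
        simp only [integral_const, probReal_univ, one_smul]
        ring
    _ ≤ ∫ p, Real.cosh (t * (X p.1 - X p.2)) ∂(μ.prod μ) :=
        integral_mono ((integrable_const 1).add (h_sq.const_mul _)) h_cosh fun p =>
          le_of_eq_of_le (by ring) (one_add_sq_div_two_le_cosh (t * (X p.1 - X p.2)))
    _ = mgf X μ t * mgf X μ (-t) := by
        simp only [Real.cosh_eq, ← neg_mul]
        rw [integral_div, integral_add (h_exp_prod t) (h_exp_prod (-t)), h_mgf, h_mgf, neg_neg]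
        ring

end ExponentialMoments

section PoincareInequality

variable [CompleteSpace E] [MeasurableSpace E] [BorelSpace E] {μ : Measure E} {κ : ℝ}
  {u : E → ℝ} {C : NNReal} {M : ℝ}

theorem HasPropertyTau.integral_exp_sub_mul_mgf_neg_le [IsFiniteMeasure μ]
    (hμ : HasPropertyTau μ κ) (hu : Differentiable ℝ u) (hC : LipschitzWith C (fderiv ℝ u))
    (hM : ∀ x, |u x| ≤ M) {t : ℝ} (ht : 0 ≤ t) (hκ : 4 * C * t < κ) :
    (∫ x, Real.exp (t * u x - t ^ 2 * (κ - 4 * C * t)⁻¹ * ‖gradient u x‖ ^ 2) ∂μ) *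
      mgf u μ (-t) ≤ 1 := by
  have h_cont : Continuous fun x =>
      t * u x - t ^ 2 * (κ - 4 * C * t)⁻¹ * ‖gradient u x‖ ^ 2 := by
    have hu_cont := hu.continuous
    have h_gradient : Continuous (gradient u) :=
      (InnerProductSpace.toDual ℝ E).symm.continuous.comp hC.continuous
    fun_prop
  have h_le (x : E) : t * u x - t ^ 2 * (κ - 4 * C * t)⁻¹ * ‖gradient u x‖ ^ 2 ≤ M * t := by
    have h_nonneg : 0 ≤ (κ - 4 * C * t)⁻¹ := inv_nonneg.2 (sub_pos.2 hκ).le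
    have h_drop : 0 ≤ t ^ 2 * (κ - 4 * C * t)⁻¹ * ‖gradient u x‖ ^ 2 :=
      mul_nonneg (mul_nonneg (sq_nonneg t) h_nonneg) (sq_nonneg _)
    nlinarith [(abs_le.1 (hM x)).2]
  refine hμ.integral_exp_mul_integral_exp_le h_cont.measurable
    (hu.continuous.measurable.const_mul (-t)) (integrable_exp_of_le h_cont.aemeasurable h_le)
    (integrable_exp_mul_of_mem_Icc hu.continuous.aemeasurable
      (.of_forall fun x => abs_le.1 (hM x))) fun x y => ?_
  have h_cost := mul_sub_sub_mul_sq_norm_fderiv_le hu hC ht hκ x y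
  rw [← norm_gradient_eq_norm_fderiv] at h_cost
  linarith

variable [IsProbabilityMeasure μ]

theorem HasPropertyTau.mgf_mul_mgf_neg_le (hμ : HasPropertyTau μ κ) (hu : Differentiable ℝ u)
    (hC : LipschitzWith C (fderiv ℝ u)) (hM : ∀ x, |u x| ≤ M) (h_grad : MemLp (gradient u) 2 μ)
    {t : ℝ} (ht : 0 ≤ t) (hκ : 4 * C * t < κ) :
    mgf u μ t * mgf u μ (-t) ≤
      1 + t ^ 2 * ((κ - 4 * C * t)⁻¹ * Real.exp (2 * M * t) * ∫ x, ‖gradient u x‖ ^ 2 ∂μ) := by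
  set c := (κ - 4 * C * t)⁻¹ with hc_def
  have hc : 0 < c := inv_pos.2 (sub_pos.2 hκ)
  have h_sq : Integrable (fun x => ‖gradient u x‖ ^ 2) μ :=
    (memLp_two_iff_integrable_sq_norm h_grad.1).1 h_grad
  have h_mgf_neg : mgf u μ (-t) ≤ Real.exp (M * t) := by
    simpa [mgf] using integral_mono (μ := μ)
      (integrable_exp_mul_of_mem_Icc (t := -t) hu.continuous.aemeasurable
        (.of_forall fun x => abs_le.1 (hM x)))
      (integrable_const (Real.exp (M * t))) fun x =>
        Real.exp_le_exp.2 (by nlinarith [(abs_le.1 (hM x)).1])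
  have h_mgf : mgf u μ t ≤ (∫ x, Real.exp (t * u x - t ^ 2 * c * ‖gradient u x‖ ^ 2) ∂μ) +
      Real.exp (M * t) * (t ^ 2 * c * ∫ x, ‖gradient u x‖ ^ 2 ∂μ) := by
    rw [← integral_const_mul]
    exact integral_exp_le_integral_exp_sub_add (hu.continuous.aemeasurable.const_mul t)
      (fun x => by nlinarith [(abs_le.1 (hM x)).2]) (h_sq.const_mul _)
      fun x => mul_nonneg (mul_nonneg (sq_nonneg t) hc.le) (sq_nonneg _)
  have h_tau := hμ.integral_exp_sub_mul_mgf_neg_le hu hC hM ht hκ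
  rw [← hc_def] at h_tau
  calc mgf u μ t * mgf u μ (-t)
      ≤ ((∫ x, Real.exp (t * u x - t ^ 2 * c * ‖gradient u x‖ ^ 2) ∂μ) +
          Real.exp (M * t) * (t ^ 2 * c * ∫ x, ‖gradient u x‖ ^ 2 ∂μ)) * mgf u μ (-t) := by
        gcongr
        exact mgf_nonneg
    _ ≤ 1 + Real.exp (M * t) * (t ^ 2 * c * ∫ x, ‖gradient u x‖ ^ 2 ∂μ) * Real.exp (M * t) := by
        rw [add_mul]
        gcongr
    _ = 1 + t ^ 2 * (c * Real.exp (2 * M * t) * ∫ x, ‖gradient u x‖ ^ 2 ∂μ) := by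
        rw [mul_assoc 2 M, two_mul, Real.exp_add]
        ring

theorem HasPropertyTau.variance_le_of_lipschitzWith_fderiv (hμ : HasPropertyTau μ κ) (hκ : 0 < κ)
    (hu : Differentiable ℝ u) (hC : LipschitzWith C (fderiv ℝ u)) (hM : ∀ x, |u x| ≤ M)
    (h_grad : MemLp (gradient u) 2 μ) :
    Var[u; μ] ≤ κ⁻¹ * ∫ x, ‖gradient u x‖ ^ 2 ∂μ := by
  set I := ∫ x, ‖gradient u x‖ ^ 2 ∂μ
  have h_near : ∀ᶠ t : ℝ in 𝓝[>] 0, 4 * C * t < κ :=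
    (Continuous.tendsto' (by fun_prop) 0 0 (by simp)).eventually_lt_const hκ
      |>.filter_mono nhdsWithin_le_nhds
  have h_bound : ∀ᶠ t : ℝ in 𝓝[>] 0,
      Var[u; μ] ≤ (κ - 4 * C * t)⁻¹ * Real.exp (2 * M * t) * I := by
    filter_upwards [h_near, self_mem_nhdsWithin] with t ht_lt (ht : 0 < t)
    have h_variance := one_add_sq_mul_variance_le_mgf_mul_mgf_neg (μ := μ)
      hu.continuous.aemeasurable (.of_forall fun x => abs_le.1 (hM x)) t
    refine le_of_mul_le_mul_left (?_ : t ^ 2 * _ ≤ t ^ 2 * _) (by positivity)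
    linarith [hμ.mgf_mul_mgf_neg_le hu hC hM h_grad ht.le ht_lt]
  have h_limit : Tendsto (fun t : ℝ => (κ - 4 * C * t)⁻¹ * Real.exp (2 * M * t) * I) (𝓝[>] 0)
      (𝓝 (κ⁻¹ * I)) := by
    have h_cont : ContinuousAt
        (fun t : ℝ => (κ - 4 * C * t)⁻¹ * Real.exp (2 * M * t) * I) 0 := by
      fun_prop (disch := simpa using hκ.ne')
    simpa using h_cont.tendsto.mono_left nhdsWithin_le_nhds
  exact ge_of_tendsto h_limit h_bound

theorem HasPropertyTau.variance_le_of_contDiff (hμ : HasPropertyTau μ κ) (hκ : 0 < κ)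
    (hu : ContDiff ℝ 2 u) (hu_supp : HasCompactSupport u) :
    Var[u; μ] ≤ κ⁻¹ * ∫ x, ‖gradient u x‖ ^ 2 ∂μ := by
  obtain ⟨C, hC⟩ := ContDiff.lipschitzWith_of_hasCompactSupport (hu_supp.fderiv ℝ)
    (hu.fderiv_right (m := 1) le_rfl) one_ne_zero
  obtain ⟨M, hM⟩ := hu_supp.exists_bound_of_continuous hu.continuous
  exact hμ.variance_le_of_lipschitzWith_fderiv hκ (hu.differentiable two_ne_zero) hC hM
    (memLp_gradient (hu.of_le one_le_two) hu_supp 2)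

end PoincareInequality

section LpConvergence

variable {α F : Type*} [MeasurableSpace α] {μ : Measure α} [NormedAddCommGroup F] {g : α → F}

theorem toReal_eLpNorm_ofReal_eq {q : ℝ} (hq : 0 < q) (hg : MemLp g (ENNReal.ofReal q) μ) :
    (eLpNorm g (ENNReal.ofReal q) μ).toReal = (∫ x, ‖g x‖ ^ q ∂μ) ^ q⁻¹ := by
  rw [hg.eLpNorm_eq_integral_rpow_norm (by simpa using hq) ENNReal.ofReal_ne_top,
    ENNReal.toReal_ofReal hq.le, ENNReal.toReal_ofReal (by positivity)]

theorem toReal_eLpNorm_two_sq (hg : MemLp g 2 μ) :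
    (eLpNorm g 2 μ).toReal ^ 2 = ∫ x, ‖g x‖ ^ 2 ∂μ := by
  have h_nonneg : 0 ≤ ∫ x, ‖g x‖ ^ 2 ∂μ := by positivity
  have h_norm := toReal_eLpNorm_ofReal_eq two_pos (by simpa using hg)
  simp only [ENNReal.ofReal_ofNat, Real.rpow_ofNat] at h_norm
  rw [h_norm, ← Real.rpow_mul_natCast h_nonneg]
  norm_num

theorem tendsto_integral_sq_norm {f : ℕ → α → F} (hf : ∀ k, MemLp (f k) 2 μ) (hg : MemLp g 2 μ)
    (h_lim : Tendsto (fun k => eLpNorm (f k - g) 2 μ) atTop (𝓝 0)) :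
    Tendsto (fun k => ∫ x, ‖f k x‖ ^ 2 ∂μ) atTop (𝓝 (∫ x, ‖g x‖ ^ 2 ∂μ)) := by
  have h_norm := ((Lp.tendsto_Lp_iff_tendsto_eLpNorm'' f hf g hg).2 h_lim).norm.pow 2
  simpa only [Lp.norm_toLp, toReal_eLpNorm_two_sq, hf, hg] using h_norm

variable [IsProbabilityMeasure μ]

theorem integral_sq_norm_le_integral_rpow_norm_rpow {q : ℝ} (hq : 2 ≤ q)
    (hg : MemLp g (ENNReal.ofReal q) μ) :
    ∫ x, ‖g x‖ ^ 2 ∂μ ≤ (∫ x, ‖g x‖ ^ q ∂μ) ^ (2 / q) := by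
  have h_exponent : 2 ≤ ENNReal.ofReal q := by simpa using ENNReal.ofReal_le_ofReal hq
  have h_nonneg : 0 ≤ ∫ x, ‖g x‖ ^ q ∂μ := by positivity
  calc ∫ x, ‖g x‖ ^ 2 ∂μ
      = (eLpNorm g 2 μ).toReal ^ 2 := (toReal_eLpNorm_two_sq (hg.mono_exponent h_exponent)).symm
    _ ≤ (eLpNorm g (ENNReal.ofReal q) μ).toReal ^ 2 := by
        gcongr
        exacts [hg.eLpNorm_ne_top, eLpNorm_le_eLpNorm_of_exponent_le h_exponent hg.1]
    _ = (∫ x, ‖g x‖ ^ q ∂μ) ^ (2 / q) := by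
        rw [toReal_eLpNorm_ofReal_eq (by linarith) hg, ← Real.rpow_mul_natCast h_nonneg,
          inv_mul_eq_div, Nat.cast_ofNat]

theorem tendsto_eLpNorm_zero_mono_exponent {f : ℕ → α → F} {p q : ℝ≥0∞} (hpq : p ≤ q)
    (hf : ∀ k, AEStronglyMeasurable (f k) μ)
    (h_lim : Tendsto (fun k => eLpNorm (f k) q μ) atTop (𝓝 0)) :
    Tendsto (fun k => eLpNorm (f k) p μ) atTop (𝓝 0) :=
  tendsto_of_tendsto_of_tendsto_of_le_of_le tendsto_const_nhds h_lim (fun _ => zero_le)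
    fun k => eLpNorm_le_eLpNorm_of_exponent_le hpq (hf k)

theorem tendsto_variance {X : ℕ → α → ℝ} {Y : α → ℝ} (hX : ∀ k, MemLp (X k) 2 μ)
    (hY : MemLp Y 2 μ) (h_lim : Tendsto (fun k => eLpNorm (X k - Y) 2 μ) atTop (𝓝 0)) :
    Tendsto (fun k => Var[X k; μ]) atTop (𝓝 Var[Y; μ]) := by
  have h_mean : Tendsto (fun k => ∫ x, X k x ∂μ) atTop (𝓝 (∫ x, Y x ∂μ)) :=
    tendsto_integral_of_L1' Y hY.1 (.of_forall fun k => (hX k).integrable one_le_two) <|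
      tendsto_eLpNorm_zero_mono_exponent one_le_two (fun k => ((hX k).sub hY).1) h_lim
  have h_second_moment := tendsto_integral_sq_norm hX hY h_lim
  simp only [Real.norm_eq_abs, sq_abs] at h_second_moment
  simp only [variance_eq_sub (hX _), variance_eq_sub hY]
  exact h_second_moment.sub (h_mean.pow 2)

end LpConvergence

section Sobolev

variable [MeasurableSpace E] [CompleteSpace E]

/-- The pair `(f, g)` is an element of a weighted Sobolev space together with its gradient: it
is a limit, in `L^p(μ)` and `L^p(μ; E)` respectively, of pairs `(u, ∇u)` with `u` a compactly
supported function of class `C^2`. -/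
def IsSobolevLimit (μ : Measure E) (p : ℝ≥0∞) (f : E → ℝ) (g : E → E) : Prop :=
  MemLp f p μ ∧ MemLp g p μ ∧ ∃ u : ℕ → E → ℝ,
    (∀ k, ContDiff ℝ 2 (u k) ∧ HasCompactSupport (u k)) ∧
    Tendsto (fun k => eLpNorm (u k - f) p μ) atTop (𝓝 0) ∧
    Tendsto (fun k => eLpNorm (gradient (u k) - g) p μ) atTop (𝓝 0)

variable [BorelSpace E] {μ : Measure E} [IsProbabilityMeasure μ] {f : E → ℝ} {g : E → E}

theorem IsSobolevLimit.mono_exponent {p q : ℝ≥0∞} (hpq : p ≤ q) (h : IsSobolevLimit μ q f g) :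
    IsSobolevLimit μ p f g := by
  obtain ⟨hf, hg, u, hu, hu_lim, h_grad_lim⟩ := h
  refine ⟨hf.mono_exponent hpq, hg.mono_exponent hpq, u, hu,
    tendsto_eLpNorm_zero_mono_exponent hpq (fun k => ?_) hu_lim,
    tendsto_eLpNorm_zero_mono_exponent hpq (fun k => ?_) h_grad_lim⟩
  · exact ((hu k).1.continuous.memLp_of_hasCompactSupport (hu k).2 (p := q)).1.sub hf.1
  · exact (memLp_gradient ((hu k).1.of_le one_le_two) (hu k).2 q).1.sub hg.1

theorem HasPropertyTau.variance_le_of_isSobolevLimit {κ : ℝ} (hμ : HasPropertyTau μ κ) (hκ : 0 < κ)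
    (h : IsSobolevLimit μ 2 f g) : Var[f; μ] ≤ κ⁻¹ * ∫ x, ‖g x‖ ^ 2 ∂μ := by
  obtain ⟨hf, hg, u, hu, hu_lim, h_grad_lim⟩ := h
  have h_variance := tendsto_variance
    (fun k => (hu k).1.continuous.memLp_of_hasCompactSupport (hu k).2) hf hu_lim
  have h_energy := tendsto_integral_sq_norm
    (fun k => memLp_gradient ((hu k).1.of_le one_le_two) (hu k).2 2) hg h_grad_lim
  exact le_of_tendsto_of_tendsto' h_variance (h_energy.const_mul κ⁻¹)
    fun k => hμ.variance_le_of_contDiff hκ (hu k).1 (hu k).2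

end Sobolev

section Hessian

variable {F : Type*} [NormedAddCommGroup F] [NormedSpace ℝ F] {f : F → ℝ} {s : Set F} {m : ℝ}

theorem concaveOn_segment_add_mul_sq (hs : Convex ℝ s)
    (hf : ∀ x ∈ s, DifferentiableAt ℝ f x) (hf' : ∀ x ∈ s, DifferentiableAt ℝ (fderiv ℝ f) x)
    (h_hess : ∀ x ∈ s, ∀ v, fderiv ℝ (fderiv ℝ f) x v v ≤ -(m * ‖v‖ ^ 2)) {x v : F}
    (hx : x ∈ s) (hxv : x + v ∈ s) :
    ConcaveOn ℝ (Icc (0 : ℝ) 1) fun t => f (x + t • v) + m / 2 * ‖v‖ ^ 2 * t ^ 2 := by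
  have h_mem {t : ℝ} (ht : t ∈ Icc (0 : ℝ) 1) : x + t • v ∈ s := hs.add_smul_mem hx hxv ht
  have h_line (t : ℝ) : HasDerivAt (fun t : ℝ => x + t • v) v t := by
    simpa using ((hasDerivAt_id t).smul_const v).const_add x
  have h_deriv {t : ℝ} (ht : t ∈ Icc (0 : ℝ) 1) :
      HasDerivAt (fun t => f (x + t • v) + m / 2 * ‖v‖ ^ 2 * t ^ 2)
        (fderiv ℝ f (x + t • v) v + m * ‖v‖ ^ 2 * t) t := by
    refine (((hf _ (h_mem ht)).hasFDerivAt.comp_hasDerivAt t (h_line t)).add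
      ((hasDerivAt_pow 2 t).const_mul (m / 2 * ‖v‖ ^ 2))).congr_deriv ?_
    norm_num
    ring
  have h_deriv2 {t : ℝ} (ht : t ∈ Icc (0 : ℝ) 1) :
      HasDerivAt (fun t => fderiv ℝ f (x + t • v) v + m * ‖v‖ ^ 2 * t)
        (fderiv ℝ (fderiv ℝ f) (x + t • v) v v + m * ‖v‖ ^ 2) t := by
    have h_fderiv := (hf' _ (h_mem ht)).hasFDerivAt.comp_hasDerivAt t (h_line t)
    refine ((h_fderiv.clm_apply (hasDerivAt_const t v)).add
      ((hasDerivAt_id t).const_mul (m * ‖v‖ ^ 2))).congr_deriv ?_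
    simp
  exact concaveOn_of_hasDerivWithinAt2_nonpos (convex_Icc 0 1)
    (fun t ht => (h_deriv ht).continuousAt.continuousWithinAt)
    (fun t ht => (h_deriv (interior_subset ht)).hasDerivWithinAt)
    (fun t ht => (h_deriv2 (interior_subset ht)).hasDerivWithinAt)
    fun t ht => by linarith [h_hess _ (h_mem (interior_subset ht)) v]

theorem strongConcaveOn_of_fderiv_fderiv_le (hs : Convex ℝ s)
    (hf : ∀ x ∈ s, DifferentiableAt ℝ f x) (hf' : ∀ x ∈ s, DifferentiableAt ℝ (fderiv ℝ f) x)
    (h_hess : ∀ x ∈ s, ∀ v, fderiv ℝ (fderiv ℝ f) x v v ≤ -(m * ‖v‖ ^ 2)) :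
    StrongConcaveOn s m f := by
  refine ⟨hs, fun x hx y hy a b ha hb hab => ?_⟩
  have h_concave := (concaveOn_segment_add_mul_sq hs hf hf' h_hess hx (v := y - x)
    (by simpa using hy)).2 (left_mem_Icc.2 zero_le_one) (right_mem_Icc.2 zero_le_one) ha hb hab
  obtain rfl : a = 1 - b := eq_sub_of_add_eq hab
  have h_point : x + b • (y - x) = (1 - b) • x + b • y := by module
  simp only [smul_eq_mul, mul_zero, mul_one, zero_add, zero_smul, one_smul, add_zero,
    add_sub_cancel, h_point] at h_concave ⊢
  rw [norm_sub_rev x y]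
  linarith

end Hessian

section WeightedGaussian

variable {n : ℕ} {w : EuclideanSpace ℝ (Fin n) → ℝ} {K : ℝ}

theorem HessianBound.strongConcaveOn_log (hK : HessianBound w K) (h_star : StarCondition w)
    (h_convex : Convex ℝ (weightSupport w)) :
    StrongConcaveOn (weightSupport w) K fun x => Real.log (w x) :=
  strongConcaveOn_of_fderiv_fderiv_le h_convex h_star.1 h_star.2.1
    fun x hx v => le_neg.2 (hK x hx v)

theorem StarCondition.neg_one_lt_curvatureConst (h_star : StarCondition w) (hn : 1 ≤ n)
    (h_nonempty : (weightSupport w).Nonempty) : -1 < curvatureConst w := by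
  obtain ⟨K, hK, hK_bound⟩ := h_star.2.2
  exact hK.trans_le ((isGreatest_curvatureConst hn w h_nonempty h_star).2 hK_bound)

theorem setOf_mul_exp_neg_sq_norm_pos (w : EuclideanSpace ℝ (Fin n) → ℝ) :
    {x | 0 < w x * Real.exp (-(1 / 2 * ‖x‖ ^ 2))} = weightSupport w := by
  simp [weightSupport, Real.exp_pos]

theorem unnormalizedMeasure_eq_withDensity (hw_nonneg : ∀ x, 0 ≤ w x)
    (h_open : IsOpen (weightSupport w)) :
    unnormalizedMeasure w =
      volume.withDensity fun x => ENNReal.ofReal (w x * Real.exp (-(1 / 2 * ‖x‖ ^ 2))) := by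
  rw [unnormalizedMeasure, ← withDensity_indicator h_open.measurableSet]
  congr with x
  by_cases hx : x ∈ weightSupport w
  · rw [indicator_of_mem hx]
    ring_nf
  · simp [indicator_of_notMem hx, le_antisymm (not_lt.1 hx) (hw_nonneg x)]

namespace IsStronglyLogConcave

theorem unnormalizedMeasure_univ_ne_zero (hw : IsStronglyLogConcave w K)
    (h_open : IsOpen (weightSupport w)) (h_nonempty : (weightSupport w).Nonempty) :
    unnormalizedMeasure w univ ≠ 0 := by
  have hw_meas := hw.measurable h_open
  have h_support : (Function.support fun x =>
      ENNReal.ofReal (w x * Real.exp (-(1 / 2 * ‖x‖ ^ 2)))) = weightSupport w := by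
    rw [← setOf_mul_exp_neg_sq_norm_pos w]
    ext x
    simp only [Function.mem_support, ne_eq, ENNReal.ofReal_eq_zero, not_le, mem_ofPred_eq]
  rw [unnormalizedMeasure_eq_withDensity hw.nonneg h_open, withDensity_apply _ .univ,
    setLIntegral_univ, ← pos_iff_ne_zero, lintegral_pos_iff_support (by fun_prop), h_support]
  exact h_open.measure_pos volume h_nonempty

theorem unnormalizedMeasure_univ_ne_top (hw : IsStronglyLogConcave w K) (hK : -1 < K)
    (h_open : IsOpen (weightSupport w)) : unnormalizedMeasure w univ ≠ ⊤ := by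
  have h_int := (hw.mul_exp_neg_sq_norm 1).integrable
    (by rwa [setOf_mul_exp_neg_sq_norm_pos]) (by linarith)
  rw [unnormalizedMeasure_eq_withDensity hw.nonneg h_open, withDensity_apply _ .univ,
    setLIntegral_univ]
  exact h_int.lintegral_lt_top.ne

theorem isProbabilityMeasure_weightedGaussian (hw : IsStronglyLogConcave w K) (hK : -1 < K)
    (h_open : IsOpen (weightSupport w)) (h_nonempty : (weightSupport w).Nonempty) :
    IsProbabilityMeasure (weightedGaussian w) where
  measure_univ := by
    rw [weightedGaussian, Measure.smul_apply, smul_eq_mul]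
    exact ENNReal.inv_mul_cancel (hw.unnormalizedMeasure_univ_ne_zero h_open h_nonempty)
      (hw.unnormalizedMeasure_univ_ne_top hK h_open)

theorem hasPropertyTau_weightedGaussian (hw : IsStronglyLogConcave w K)
    (h_open : IsOpen (weightSupport w)) [IsProbabilityMeasure (weightedGaussian w)] :
    HasPropertyTau (weightedGaussian w) (K + 1) := by
  have h_eq : weightedGaussian w = (unnormalizedMeasure w univ)⁻¹ •
      volume.withDensity fun x => ENNReal.ofReal (w x * Real.exp (-(1 / 2 * ‖x‖ ^ 2))) := by
    rw [weightedGaussian, ← unnormalizedMeasure_eq_withDensity hw.nonneg h_open]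
  have h_prob : IsProbabilityMeasure ((unnormalizedMeasure w univ)⁻¹ •
      volume.withDensity fun x => ENNReal.ofReal (w x * Real.exp (-(1 / 2 * ‖x‖ ^ 2)))) :=
    h_eq ▸ ‹_›
  have hw_meas := hw.measurable h_open
  rw [h_eq]
  exact (hw.mul_exp_neg_sq_norm 1).hasPropertyTau (by fun_prop)

end IsStronglyLogConcave

theorem IsSobolevWithGradient.isSobolevLimit {q : ℝ} {f : EuclideanSpace ℝ (Fin n) → ℝ}
    {g : EuclideanSpace ℝ (Fin n) → EuclideanSpace ℝ (Fin n)}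
    (h : IsSobolevWithGradient w q f g) :
    IsSobolevLimit (weightedGaussian w) (ENNReal.ofReal q) f g := by
  obtain ⟨hf, hg, u, hu, hu_lim, h_grad_lim⟩ := h
  exact ⟨hf, hg, u, fun k => ⟨(hu k).1.of_le (by norm_cast), (hu k).2.1⟩, hu_lim,
    h_grad_lim⟩

end WeightedGaussian

theorem theorem1p3_general (n : ℕ) (w : EuclideanSpace ℝ (Fin n) → ℝ) (K : ℝ) (hK : -1 < K)
    (hw : IsStronglyLogConcave w K) (h_open : IsOpen (weightSupport w))
    (h_nonempty : (weightSupport w).Nonempty) :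
    IsProbabilityMeasure (weightedGaussian w) ∧
    ∀ q : ℝ, 2 ≤ q →
      ∀ (f : EuclideanSpace ℝ (Fin n) → ℝ)
        (g : EuclideanSpace ℝ (Fin n) → EuclideanSpace ℝ (Fin n)),
        IsSobolevLimit (weightedGaussian w) (ENNReal.ofReal q) f g →
        ∫ x, |f x - ∫ y, f y ∂(weightedGaussian w)| ^ 2 ∂(weightedGaussian w) ≤
          1 / (1 + K) * (∫ x, ‖g x‖ ^ q ∂(weightedGaussian w)) ^ (2 / q) := by
  have h_prob := hw.isProbabilityMeasure_weightedGaussian hK h_open h_nonempty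
  refine ⟨h_prob, fun q hq f g hfg => ?_⟩
  have hK_pos : 0 < K + 1 := neg_lt_iff_pos_add.1 hK
  have h_two : IsSobolevLimit (weightedGaussian w) 2 f g :=
    hfg.mono_exponent (by simpa using ENNReal.ofReal_le_ofReal hq)
  calc ∫ x, |f x - ∫ y, f y ∂(weightedGaussian w)| ^ 2 ∂(weightedGaussian w)
      = Var[f; weightedGaussian w] := by
        simp only [sq_abs, variance_eq_integral h_two.1.aemeasurable]
    _ ≤ (K + 1)⁻¹ * ∫ x, ‖g x‖ ^ 2 ∂(weightedGaussian w) :=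
        (hw.hasPropertyTau_weightedGaussian h_open).variance_le_of_isSobolevLimit hK_pos h_two
    _ ≤ (K + 1)⁻¹ * (∫ x, ‖g x‖ ^ q ∂(weightedGaussian w)) ^ (2 / q) := by
        gcongr
        exact integral_sq_norm_le_integral_rpow_norm_rpow hq hfg.2.1
    _ = 1 / (1 + K) * (∫ x, ‖g x‖ ^ q ∂(weightedGaussian w)) ^ (2 / q) := by
        rw [one_div, add_comm]

theorem theorem1p3 (n : ℕ) (hn : 1 ≤ n) (w : EuclideanSpace ℝ (Fin n) → ℝ)
    (hw_nonneg : ∀ x, 0 ≤ w x)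
    (h_nonempty : (weightSupport w).Nonempty)
    (h_open : IsOpen (weightSupport w))
    (h_convex : Convex ℝ (weightSupport w))
    (h_star : StarCondition w) :
    MeasureTheory.IsProbabilityMeasure (weightedGaussian w) ∧
    ∀ (q : ℝ), 2 ≤ q →
      ∀ (f : EuclideanSpace ℝ (Fin n) → ℝ)
        (g : EuclideanSpace ℝ (Fin n) → EuclideanSpace ℝ (Fin n)),
        IsSobolevWithGradient w q f g →
        ∫ x, |f x - ∫ y, f y ∂(weightedGaussian w)| ^ 2 ∂(weightedGaussian w) ≤
          1 / (1 + curvatureConst w) *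
            (∫ x, ‖g x‖ ^ q ∂(weightedGaussian w)) ^ (2 / q) := by
  have hw : IsStronglyLogConcave w (curvatureConst w) :=
    ⟨hw_nonneg, (isGreatest_curvatureConst hn w h_nonempty h_star).1.strongConcaveOn_log h_star
      h_convex⟩
  obtain ⟨h_prob, h_poincare⟩ := theorem1p3_general n w _
    (h_star.neg_one_lt_curvatureConst hn h_nonempty) hw h_open h_nonempty
  exact ⟨h_prob, fun q hq f g hfg => h_poincare q hq f g hfg.isSobolevLimit⟩
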